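/- Let $X$ be an infinite set of cardinality $\lambda$ and let $n\ge 1$ be an integer. Let $\mathscr{I}_\lambda^n$ be the semigroup of all partial one-to-one transformations $\alpha$ of $X$ (bijections between subsets of $X$) of rank $|\operatorname{ran}\alpha|\le n$, with the composition of partial maps $x(\alpha\beta)=(x\alpha)\beta$, defined for those $x\in\operatorname{dom}\alpha$ with $x\alpha\in\operatorname{dom}\beta$. A topological semigroup is a semigroup with a Hausdorff topology for which the multiplication is jointly continuous. A topological space is pseudocompact if every locally finite family of non-empty open subsets of it is finite. Let $S$ be a Tychonoff topological semigroup whose square $S\times S$ is pseudocompact. Then: 1. for every Hausdorff topology on $\mathscr{I}_\lambda^n$ that makes it a topological semigroup, every continuous homomorphism $h\colon\mathscr{I}_\lambda^n\to S$ is annihilating, that is, there is $c\in S$ with $h(\alpha)=c$ for all $\alpha\in\mathscr{I}_\lambda^n$; 2. $S$ does not contain $\mathscr{I}_\lambda^n$, that is, no subsemigroup of $S$ is (algebraically) isomorphic to $\mathscr{I}_\lambda^n$. -/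

import Mathlib

universe u v

/-- The set of all partial one-to-one transformations of a set `X`. -/
def SymmetricInverseSemigroup (X : Type u) : Type u := X ≃. X

namespace SymmetricInverseSemigroup

variable {X : Type u}

/-- The semigroup operation is composition of partial maps, written from left to right:
`x (α β) = (x α) β` whenever `x ∈ dom α` and `x α ∈ dom β`, and undefined otherwise. -/
instance : Semigroup (SymmetricInverseSemigroup X) where
  mul α β := PEquiv.trans α β
  mul_assoc α β γ := PEquiv.trans_assoc α β γ

/-- The range of a partial one-to-one transformation. -/
def ran (α : SymmetricInverseSemigroup X) : Set X :=
  {y | ∃ x, PEquiv.toFun α x = some y}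

/-- The rank of a partial one-to-one transformation: the number of elements of its range. -/
noncomputable def rank (α : SymmetricInverseSemigroup X) : ℕ∞ := (ran α).encard

theorem ran_mul_subset (α β : SymmetricInverseSemigroup X) : ran (α * β) ⊆ ran β := by
  rintro y ⟨x, hx⟩
  obtain ⟨z, -, hz⟩ := Option.bind_eq_some_iff.1 hx
  exact ⟨z, hz⟩

end SymmetricInverseSemigroup

/-- The semigroup of all partial one-to-one transformations of `X` of rank at most `n`. -/
def FiniteRankSymmetricInverseSemigroup (X : Type u) (n : ℕ) :
    Subsemigroup (SymmetricInverseSemigroup X) where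
  carrier := {α | α.rank ≤ n}
  mul_mem' {α β} _ hβ :=
    (Set.encard_le_encard (SymmetricInverseSemigroup.ran_mul_subset α β)).trans hβ

/-- A topological space is pseudocompact if every locally finite family of non-empty open
subsets is finite. -/
def IsPseudocompactSpace (Y : Type u) [TopologicalSpace Y] : Prop :=
  ∀ 𝒰 : Set (Set Y), (∀ U ∈ 𝒰, IsOpen U ∧ U.Nonempty) →
    LocallyFinite (fun U : 𝒰 => (U : Set Y)) → 𝒰.Finite

/-- A homomorphism of semigroups is annihilating if it is constant. -/
def IsAnnihilating {S : Type u} {T : Type v} [Semigroup S] [Semigroup T] (h : S →ₙ* T) : Prop :=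
  ∃ c : T, ∀ a : S, h a = c

/-! Infinitely many disjoint copies of `ran α` give maps `b i`, `c i` between copy 0 and copy `i`,
with `b i * c i` the identity `e` of `ran α` and `b i * c j` empty for `i ≠ j`. In `S` the images of
`e` and the empty map coincide: otherwise a continuous `f` separates them, and pseudocompactness of
`S × S` makes `x ↦ f (x * ·)` continuous in the sup norm, so two distinct `b i`, `b j` act almost
equally on `c i`, which is absurd. Since `α = α * e`, `h α` is the image of the empty map. An
embedding would also be constant, yet there is a nonempty map. -/

open Topology Set

/-! ### Pseudocompact products -/

/-- In a pseudocompact space every sequence of nonempty open sets has a cluster point. -/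
theorem IsPseudocompactSpace.exists_cluster_point {Y : Type u} [TopologicalSpace Y]
    (hY : IsPseudocompactSpace Y) (W : ℕ → Set Y) (hW : ∀ n, IsOpen (W n) ∧ (W n).Nonempty) :
    ∃ p, ∀ N ∈ 𝓝 p, {n | (W n ∩ N).Nonempty}.Infinite := by
  by_contra! hcon
  have hfin : (range W).Finite := by
    refine hY (range W) (by rintro _ ⟨n, rfl⟩; exact hW n) fun p => ?_
    obtain ⟨N, hN, hNfin⟩ := hcon p
    refine ⟨N, hN, Finite.of_finite_image ((hNfin.image W).subset ?_)
      Subtype.val_injective.injOn⟩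
    rintro _ ⟨⟨_, n, rfl⟩, hn, rfl⟩
    exact ⟨n, hn, rfl⟩
  have := hfin.to_subtype
  -- Some open set recurs infinitely often, so each of its points is a cluster point.
  obtain ⟨⟨_, m, rfl⟩, hm⟩ := Finite.exists_infinite_fiber (rangeFactorization W)
  obtain ⟨p, hp⟩ := (hW m).2
  obtain ⟨N, hN, hNfin⟩ := hcon p
  refine (infinite_coe_iff.1 hm) (hNfin.subset fun k hk => ?_)
  have hk' : W k = W m := congrArg Subtype.val hk
  exact ⟨p, hk' ▸ hp, mem_of_mem_nhds hN⟩

/-- If `A × B` is pseudocompact, then for continuous `F : A × B → ℝ` the map `x ↦ F (x, ·)` is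
continuous with respect to uniform convergence. -/
theorem IsPseudocompactSpace.eventually_forall_abs_sub_le {A B : Type u} [TopologicalSpace A]
    [TopologicalSpace B] (hAB : IsPseudocompactSpace (A × B)) {F : A × B → ℝ}
    (hF : Continuous F) (a : A) {ε : ℝ} (hε : 0 < ε) :
    ∀ᶠ x in 𝓝 a, ∀ y, |F (x, y) - F (a, y)| ≤ ε := by
  by_contra hcon
  -- `W'` is shrunk so that over `V` all of `F (w, ·)` stays near `F (a, y)`; later sets `U` will
  -- lie inside it.
  have step : ∀ W : {W : Set A // W ∈ 𝓝 a}, ∃ (W' : {W : Set A // W ∈ 𝓝 a}) (U : Set A)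
      (V : Set B), W'.1 ⊆ W.1 ∧ U ⊆ W.1 ∧ (IsOpen U ∧ U.Nonempty) ∧ (IsOpen V ∧ V.Nonempty) ∧
        ∀ u ∈ U, ∀ w ∈ W'.1, ∀ v ∈ V, ε / 2 < |F (u, v) - F (w, v)| := by
    rintro ⟨W, hW⟩
    have hfr := Filter.not_eventually.1 hcon
    obtain ⟨x, hx, hxW⟩ := (hfr.and_eventually (interior_mem_nhds.2 hW)).exists
    push Not at hx
    obtain ⟨y, hy⟩ := hx
    have near : ∀ p : A × B, {q | |F q - F p| < ε / 4} ∈ 𝓝 p := fun p =>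
      hF.continuousAt (Metric.ball_mem_nhds (F p) (by positivity))
    obtain ⟨U, V, hU, hxU, hV, hyV, hUV⟩ := mem_nhds_prod_iff'.1 (near (x, y))
    obtain ⟨U', V', hU', haU', hV', hyV', hUV'⟩ := mem_nhds_prod_iff'.1 (near (a, y))
    refine ⟨⟨U' ∩ W, Filter.inter_mem (hU'.mem_nhds haU') hW⟩, U ∩ interior W, V ∩ V',
      inter_subset_right, inter_subset_right.trans interior_subset,
      ⟨hU.inter isOpen_interior, x, hxU, hxW⟩, ⟨hV.inter hV', y, hyV, hyV'⟩, ?_⟩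
    intro u hu w hw v hv
    have h1 : |F (u, v) - F (x, y)| < ε / 4 := hUV (mk_mem_prod hu.1 hv.1)
    have h2 : |F (w, v) - F (a, y)| < ε / 4 := hUV' (mk_mem_prod hw.1 hv.2)
    rw [abs_lt] at h1 h2
    rw [lt_abs] at hy ⊢
    rcases hy with hy | hy
    · left; linarith
    · right; linarith
  choose next U V hnext hUsub hU hV hsep using step
  let W : ℕ → {W : Set A // W ∈ 𝓝 a} := fun n =>
    Nat.rec ⟨univ, Filter.univ_mem⟩ (fun _ w => next w) n
  have hanti : Antitone fun n => (W n).1 := antitone_nat_of_succ_le fun n => hnext (W n)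
  obtain ⟨p, hp⟩ := hAB.exists_cluster_point (fun n => U (W n) ×ˢ V (W n)) fun n =>
    ⟨(hU _).1.prod (hV _).1, (hU _).2.prod (hV _).2⟩
  have hnear : {q | |F q - F p| < ε / 4} ∈ 𝓝 p :=
    hF.continuousAt (Metric.ball_mem_nhds (F p) (by positivity))
  obtain ⟨G, H, hG, hpG, hH, hpH, hGH⟩ := mem_nhds_prod_iff'.1 hnear
  have hinf := hp (G ×ˢ H) (prod_mem_nhds (hG.mem_nhds hpG) (hH.mem_nhds hpH))
  obtain ⟨n, ⟨u, v⟩, ⟨huU, hvV⟩, huG, hvH⟩ := hinf.nonempty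
  obtain ⟨m, ⟨⟨w, _⟩, ⟨hwU, -⟩, hwG, -⟩, hnm⟩ := hinf.exists_gt n
  -- As `n < m`, `w` lies in the neighbourhood chosen at stage `n`; pairing it with the `v` of stage
  -- `n` keeps both points in `G ×ˢ H`.
  have h := hsep (W n) u huU w (hanti (Nat.succ_le_of_lt hnm) (hUsub _ hwU)) v hvV
  have h1 : |F (u, v) - F p| < ε / 4 := hGH (mk_mem_prod huG hvH)
  have h2 : |F (w, v) - F p| < ε / 4 := hGH (mk_mem_prod hwG hvH)
  rw [abs_lt] at h1 h2
  rw [lt_abs] at h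
  rcases h with h | h <;> linarith

/-- A Tychonoff topological semigroup with pseudocompact square contains no infinite nontrivial
system of matrix units. -/
theorem IsPseudocompactSpace.eq_of_matrix_units {S : Type v} [Semigroup S] [TopologicalSpace S]
    [ContinuousMul S] [T35Space S] (hS : IsPseudocompactSpace (S × S)) {b c : ℕ → S} {e z : S}
    (hbc : ∀ i, b i * c i = e) (hz : ∀ i j, i ≠ j → b i * c j = z) : e = z := by
  by_contra hne
  obtain ⟨f, hf, hfe, hfz⟩ := CompletelyRegularSpace.completely_regular e {z} isClosed_singleton hne
  let F : S × S → ℝ := fun p => f (p.1 * p.2)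
  have hF : Continuous F := continuous_subtype_val.comp (hf.comp continuous_mul)
  have hequi := fun x : S =>
    -- The chain `b i, u, p.1, w, b j` has four links, and 4/5 < 1.
    mem_nhds_iff.1 (hS.eventually_forall_abs_sub_le hF x (ε := 1 / 5) (by norm_num))
  choose W hW hWo hxW using hequi
  -- The points `b i` are thickened to open sets, the only ones that pseudocompactness controls.
  obtain ⟨p, hp⟩ := hS.exists_cluster_point (fun i => W (b i) ×ˢ univ) fun i =>
    ⟨(hWo _).prod isOpen_univ, (b i, e), hxW _, mem_univ _⟩
  have hinf := hp (W p.1 ×ˢ univ) (((hWo p.1).prod isOpen_univ).mem_nhds ⟨hxW _, mem_univ _⟩)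
  obtain ⟨i, ⟨u, _⟩, ⟨hui, _⟩, hup, _⟩ := hinf.nonempty
  obtain ⟨j, ⟨⟨w, _⟩, ⟨hwj, _⟩, hwp, _⟩, hij⟩ := hinf.exists_gt i
  have h1 := abs_le.1 (hW _ hui (c i))
  have h2 := abs_le.1 (hW _ hup (c i))
  have h3 := abs_le.1 (hW _ hwj (c i))
  have h4 := abs_le.1 (hW _ hwp (c i))
  have h5 : F (b i, c i) = 0 := by simp [F, hbc, hfe]
  have h6 : F (b j, c i) = 1 := by simp [F, hz j i hij.ne', hfz (mem_singleton z)]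
  linarith [h1.1, h1.2, h2.1, h2.2, h3.1, h3.2, h4.1, h4.2]

/-! ### Disjoint copies of a finite set -/

/-- The everywhere defined partial bijection given by an injective function. -/
noncomputable def PEquiv.ofInjective {A : Type u} {X : Type v} (s : A → X)
    (hs : Function.Injective s) : A ≃. X where
  toFun a := some (s a)
  invFun := Function.partialInv s
  inv a x := by
    exact (hs.isPartialInv a x).trans Option.some_inj.symm

theorem PEquiv.ofInjective_trans_symm {A : Type u} {X : Type v} (s : A → X)
    (hs : Function.Injective s) :
    (PEquiv.ofInjective s hs).trans (PEquiv.ofInjective s hs).symm = PEquiv.refl A := by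
  ext a a'
  change a' ∈ Function.partialInv s (s a) ↔ a' ∈ some a
  rw [Function.partialInv_left hs]

theorem PEquiv.ofInjective_trans_symm_of_disjoint {A : Type u} {X : Type v} {s t : A → X}
    (hs : Function.Injective s) (ht : Function.Injective t) (hst : ∀ a a', s a ≠ t a') :
    (PEquiv.ofInjective s hs).trans (PEquiv.ofInjective t ht).symm = ⊥ := by
  ext a a'
  change a' ∈ Function.partialInv t (s a) ↔ a' ∈ none
  rw [Option.mem_def, ht.isPartialInv a' (s a)]
  simpa using (hst a a').symm

/-- A finite subset of an infinite set belongs to an infinite sequence of disjoint copies. -/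
theorem exists_disjoint_copies {X : Type u} [Infinite X] (A : Set X) (hA : A.Finite) :
    ∃ s : ℕ → A → X, s 0 = Subtype.val ∧ (∀ i, Function.Injective (s i)) ∧
      ∀ i j, i ≠ j → ∀ a a', s i a ≠ s j a' := by
  have := hA.to_subtype
  have := hA.infinite_compl.to_subtype
  obtain ⟨k⟩ : Nonempty ((ℕ × A) ↪ ℕ) := ⟨(nonempty_embedding_nat _).some⟩
  let ψ : (ℕ × A) ↪ (Aᶜ : Set X) := k.trans (Infinite.natEmbedding _)
  -- Copy 0 is `A` itself; all the others lie in its complement.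
  refine ⟨fun i a => if i = 0 then a else ψ (i, a), rfl, fun i a a' h => ?_, fun i j hij a a' h => ?_⟩
  · by_cases hi : i = 0
    · simpa [hi, Subtype.ext_iff] using h
    · simpa [hi, Subtype.val_inj] using h
  · by_cases hi : i = 0 <;> by_cases hj : j = 0
    · exact hij (hi.trans hj.symm)
    · simp only [hi, hj, if_true, if_false] at h
      exact (ψ (j, a')).2 (h ▸ a.2)
    · simp only [hi, hj, if_true, if_false] at h
      exact (ψ (i, a)).2 (h ▸ a'.2)
    · simp only [hi, hj, if_false, Subtype.val_inj, EmbeddingLike.apply_eq_iff_eq,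
        Prod.mk.injEq] at h
      exact hij h.1

/-! ### Matrix units of finite rank -/

namespace FiniteRankSymmetricInverseSemigroup

variable {X : Type u} {n : ℕ}

/-- The empty partial map. -/
def empty : FiniteRankSymmetricInverseSemigroup X n :=
  ⟨(⊥ : X ≃. X), by
    have : SymmetricInverseSemigroup.ran (⊥ : X ≃. X) = ∅ :=
      eq_empty_of_forall_notMem fun y ⟨x, hx⟩ => Option.some_ne_none y hx.symm
    change (SymmetricInverseSemigroup.ran (⊥ : X ≃. X)).encard ≤ _
    rw [this, encard_empty]
    exact zero_le⟩

theorem mul_empty (α : FiniteRankSymmetricInverseSemigroup X n) : α * empty = empty :=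
  Subtype.ext (PEquiv.trans_bot (α.1 : X ≃. X))

/-- The partial map `s a ↦ t a`, where `a` runs over the set `A` of at most `n` elements. -/
noncomputable def matrixUnit {A : Set X} (hA : A.encard ≤ n) {s t : A → X}
    (hs : Function.Injective s) (ht : Function.Injective t) :
    FiniteRankSymmetricInverseSemigroup X n :=
  ⟨((PEquiv.ofInjective s hs).symm.trans (PEquiv.ofInjective t ht) : X ≃. X), by
    have hsub : SymmetricInverseSemigroup.ran
        ((PEquiv.ofInjective s hs).symm.trans (PEquiv.ofInjective t ht)) ⊆ range t := by
      rintro y ⟨x, hx⟩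
      obtain ⟨a, -, ha⟩ := Option.bind_eq_some_iff.1 hx
      exact ⟨a, Option.some_inj.1 ha⟩
    refine (encard_le_encard hsub).trans ?_
    rw [← image_univ, ht.encard_image, encard_univ, ENat.card_coe_set_eq]
    exact hA⟩

variable {A : Set X} (hA : A.encard ≤ n) {r s t q : A → X} (hr : Function.Injective r)
  (hs : Function.Injective s) (ht : Function.Injective t) (hq : Function.Injective q)

theorem matrixUnit_mul_matrixUnit :
    matrixUnit hA hr hs * matrixUnit hA hs ht = matrixUnit hA hr ht := by
  apply Subtype.ext
  change ((PEquiv.ofInjective r hr).symm.trans (PEquiv.ofInjective s hs)).trans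
    ((PEquiv.ofInjective s hs).symm.trans (PEquiv.ofInjective t ht)) =
      (PEquiv.ofInjective r hr).symm.trans (PEquiv.ofInjective t ht)
  rw [PEquiv.trans_assoc, ← PEquiv.trans_assoc (PEquiv.ofInjective s hs),
    PEquiv.ofInjective_trans_symm, PEquiv.refl_trans]

theorem matrixUnit_mul_matrixUnit_of_disjoint (hst : ∀ a a', s a ≠ t a') :
    matrixUnit hA hr hs * matrixUnit hA ht hq = empty := by
  apply Subtype.ext
  change ((PEquiv.ofInjective r hr).symm.trans (PEquiv.ofInjective s hs)).trans
    ((PEquiv.ofInjective t ht).symm.trans (PEquiv.ofInjective q hq)) = (⊥ : X ≃. X)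
  rw [PEquiv.trans_assoc, ← PEquiv.trans_assoc (PEquiv.ofInjective s hs),
    PEquiv.ofInjective_trans_symm_of_disjoint hs ht hst, PEquiv.bot_trans, PEquiv.trans_bot]

/-- This unit is the identity on `ran α`. Keeping `hval` as an equation lets `s` be a member of a
family of copies. -/
theorem mul_matrixUnit_self (α : FiniteRankSymmetricInverseSemigroup X n)
    (hα : α.1.ran.encard ≤ n) {s : α.1.ran → X} (hs : Function.Injective s)
    (hval : s = Subtype.val) : α * matrixUnit hα hs hs = α := by
  subst hval
  apply Subtype.ext
  refine PEquiv.ext fun x => ?_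
  change (PEquiv.toFun α.1 x).bind (fun y => (Function.partialInv Subtype.val y).bind
    fun a : α.1.ran => some a.1) = PEquiv.toFun α.1 x
  rcases hx : PEquiv.toFun α.1 x with _ | y
  · rfl
  · have : Function.partialInv Subtype.val y = some (⟨y, x, hx⟩ : α.1.ran) :=
      Function.partialInv_left hs ⟨y, x, hx⟩
    simp [this]

/-- Homomorphisms into Tychonoff topological semigroups with pseudocompact square are constant. -/
theorem isAnnihilating [Infinite X] {S : Type v} [Semigroup S] [TopologicalSpace S]
    [ContinuousMul S] [T35Space S] (hS : IsPseudocompactSpace (S × S))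
    (h : FiniteRankSymmetricInverseSemigroup X n →ₙ* S) : IsAnnihilating h := by
  refine ⟨h empty, fun α => ?_⟩
  have hα : α.1.ran.encard ≤ n := α.2
  obtain ⟨s, hs0, hs, hdis⟩ := exists_disjoint_copies α.1.ran
    (finite_of_encard_le_coe hα)
  have key : h (matrixUnit hα (hs 0) (hs 0)) = h empty :=
    hS.eq_of_matrix_units (b := fun i => h (matrixUnit hα (hs 0) (hs i)))
      (c := fun i => h (matrixUnit hα (hs i) (hs 0)))
      (fun i => by rw [← map_mul, matrixUnit_mul_matrixUnit])
      (fun i j hij => by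
        rw [← map_mul, matrixUnit_mul_matrixUnit_of_disjoint _ _ _ _ _ (hdis i j hij)])
  have hmul : α * matrixUnit hα (hs 0) (hs 0) = α :=
    mul_matrixUnit_self α hα (hs 0) hs0
  calc h α = h α * h (matrixUnit hα (hs 0) (hs 0)) := by rw [← map_mul, hmul]
    _ = h empty := by rw [key, ← map_mul, mul_empty]

/-- The semigroup of partial bijections of positive finite rank bound is nontrivial. -/
theorem exists_ne_empty [Nonempty X] (hn : 1 ≤ n) :
    ∃ α : FiniteRankSymmetricInverseSemigroup X n, α ≠ empty := by
  obtain ⟨x⟩ := ‹Nonempty X›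
  have hx : ({x} : Set X).encard ≤ n := by
    rw [encard_singleton]
    exact_mod_cast hn
  have hv : Function.Injective (Subtype.val : ({x} : Set X) → X) := Subtype.val_injective
  refine ⟨matrixUnit hx hv hv, fun h => ?_⟩
  have h' : ((Function.partialInv Subtype.val x).bind fun a : ({x} : Set X) => some a.1) = none :=
    congrArg (fun β : FiniteRankSymmetricInverseSemigroup X n => PEquiv.toFun β.1 x) h
  have hp : Function.partialInv Subtype.val x = some (⟨x, rfl⟩ : ({x} : Set X)) :=
    Function.partialInv_left hv ⟨x, rfl⟩
  simp [hp] at h'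

end FiniteRankSymmetricInverseSemigroup

theorem mainTheorem5 {X : Type u} [Infinite X] (n : ℕ) (hn : 1 ≤ n)
    {S : Type v} [Semigroup S] [TopologicalSpace S] [ContinuousMul S] [T35Space S]
    (hS : IsPseudocompactSpace (S × S)) :
    (∀ [TopologicalSpace (FiniteRankSymmetricInverseSemigroup X n)]
        [T2Space (FiniteRankSymmetricInverseSemigroup X n)]
        [ContinuousMul (FiniteRankSymmetricInverseSemigroup X n)]
        (h : FiniteRankSymmetricInverseSemigroup X n →ₙ* S),
        Continuous h → IsAnnihilating h) ∧
      ¬ ∃ T : Subsemigroup S, Nonempty (FiniteRankSymmetricInverseSemigroup X n ≃* T) := by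
  refine ⟨fun h _ => FiniteRankSymmetricInverseSemigroup.isAnnihilating hS h, ?_⟩
  rintro ⟨T, ⟨φ⟩⟩
  obtain ⟨c, hc⟩ := FiniteRankSymmetricInverseSemigroup.isAnnihilating hS
    ((MulMemClass.subtype T).comp φ.toMulHom)
  obtain ⟨α, hα⟩ := FiniteRankSymmetricInverseSemigroup.exists_ne_empty (X := X) hn
  exact hα (φ.injective (Subtype.ext ((hc α).trans (hc _).symm)))
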